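/- Let $\mathbb T=\mathbb R/\mathbb Z$ and, for $r\in\mathbb N\cup\{\infty,\omega\}$, let $\mathrm{Diff}^r_+(\mathbb T)$ be the group of orientation preserving homeomorphisms of $\mathbb T$ that are of class $C^r$ together with their inverses. Let $r\ge 1$ and let $f\in \mathrm{Diff}^r_+(\mathbb T)$ have irrational rotation number $\rho(f)=\alpha \bmod 1$, with $\alpha\in(0,1)\setminus\mathbb Q$. Let $p_n/q_n$ ($n\ge 0$), in lowest terms, be the convergents of the continued fraction of $\alpha$. For $x\in\mathbb T$ let $I_n(x)$ be the open arc that goes in the positive direction from $x$ to $f^{q_n}(x)$ if $n$ is even, and from $f^{q_n}(x)$ to $x$ if $n$ is odd. Let $\beta_n(x)=|I_n(x)|$ be its length and let $$m_n=\min_{x\in\mathbb T}\beta_n(x),\qquad M_n=\max_{x\in\mathbb T}\beta_n(x).$$ If the sequence $(M_n/m_n)_{n\ge 0}$ is bounded, then $f$ is $C^1$-conjugated to the rotation $T_\alpha:x\mapsto x+\alpha$, that is, there is $h\in\mathrm{Diff}^1_+(\mathbb T)$ with $h\circ f=T_\alpha\circ h$. -/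

import Mathlib

open Set Filter Topology MeasureTheory

noncomputable section

namespace CircleDyn

/-- `F : ℝ → ℝ` is a lift of the circle map `f : ℝ/ℤ → ℝ/ℤ`. -/
def IsLift (F : ℝ → ℝ) (f : UnitAddCircle → UnitAddCircle) : Prop :=
  ∀ x : ℝ, f (x : UnitAddCircle) = ((F x : ℝ) : UnitAddCircle)

/-- `Diff₊^r(ℝ/ℤ)`: the homeomorphisms of the circle that have a lift to `ℝ` which is an increasing
bijection commuting with `x ↦ x + 1` (a unit of the monoid `CircleDeg1Lift`), of class `C^r`
together with its inverse. Here `r` is a natural number, `∞` or `ω`. -/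
structure CircleDiffeo (r : WithTop ℕ∞) extends UnitAddCircle ≃ₜ UnitAddCircle where
  exists_lift : ∃ F : CircleDeg1Liftˣ, IsLift F toFun ∧
    ContDiff ℝ r (F : ℝ → ℝ) ∧ ContDiff ℝ r ((F⁻¹ : CircleDeg1Liftˣ) : ℝ → ℝ)

namespace CircleDiffeo

variable {r : WithTop ℕ∞}

instance : CoeFun (CircleDiffeo r) fun _ => UnitAddCircle → UnitAddCircle :=
  ⟨fun f => f.toHomeomorph⟩

/-- A lift of `f` (any two of them differ by an integer constant). -/
def lift (f : CircleDiffeo r) : CircleDeg1Liftˣ := f.exists_lift.choose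

theorem isLift_lift (f : CircleDiffeo r) : IsLift f.lift f := f.exists_lift.choose_spec.1

/-- The rotation number of `f` in `ℝ/ℤ`: the class modulo `1` of the translation number
`lim (Fⁿ(x) - x) / n` of a lift `F` of `f`. -/
def rotationNumber (f : CircleDiffeo r) : UnitAddCircle :=
  ((f.lift : CircleDeg1Lift).translationNumber : UnitAddCircle)

end CircleDiffeo

/-- Two lifts of one circle map have the same translation number modulo `1`. -/
theorem translationNumber_coe_eq_of_isLift {f : UnitAddCircle → UnitAddCircle}
    (F G : CircleDeg1Liftˣ) (hF : IsLift F f) (hG : IsLift G f) :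
    ((F : CircleDeg1Lift).translationNumber : UnitAddCircle)
      = ((G : CircleDeg1Lift).translationNumber : UnitAddCircle) := by
  have hFc : Continuous (F : ℝ → ℝ) :=
    (CircleDeg1Lift.continuous_iff_surjective _).2
      (CircleDeg1Lift.isUnit_iff_bijective.1 F.isUnit).2
  have hGc : Continuous (G : ℝ → ℝ) :=
    (CircleDeg1Lift.continuous_iff_surjective _).2
      (CircleDeg1Lift.isUnit_iff_bijective.1 G.isUnit).2
  have hk : ∀ x : ℝ, ∃ k : ℤ, (k : ℝ) = F x - G x := by
    intro x
    have h : ((F x : ℝ) : UnitAddCircle) = ((G x : ℝ) : UnitAddCircle) :=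
      (hF x).symm.trans (hG x)
    rw [← sub_eq_zero, ← AddCircle.coe_sub, AddCircle.coe_eq_zero_iff] at h
    obtain ⟨k, hk⟩ := h
    exact ⟨k, by simpa using hk⟩
  choose k hk using hk
  have hkc : Continuous k := by
    rw [Int.isClosedEmbedding_coe_real.isInducing.continuous_iff]
    have : ((↑) : ℤ → ℝ) ∘ k = fun x => F x - G x := funext hk
    rw [this]
    exact hFc.sub hGc
  have hconst : ∀ x, k x = k 0 := fun x =>
    PreconnectedSpace.constant inferInstance hkc
  have hFG : (F : CircleDeg1Lift)
      = (CircleDeg1Lift.translate (Multiplicative.ofAdd ((k 0 : ℤ) : ℝ)) : CircleDeg1Lift) * G := by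
    ext x
    have := hk x
    rw [hconst x] at this
    simp only [CircleDeg1Lift.mul_apply, CircleDeg1Lift.translate_apply]
    linarith
  have hcomm : Commute
      (CircleDeg1Lift.translate (Multiplicative.ofAdd ((k 0 : ℤ) : ℝ)) : CircleDeg1Lift) G := by
    rw [CircleDeg1Lift.commute_iff_commute]
    intro x
    simp [CircleDeg1Lift.translate_apply]
  rw [hFG, CircleDeg1Lift.translationNumber_mul_of_commute hcomm,
    CircleDeg1Lift.translationNumber_translate, AddCircle.coe_add]
  have : (((k 0 : ℤ) : ℝ) : UnitAddCircle) = 0 :=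
    (AddCircle.coe_eq_zero_iff (1 : ℝ)).2 ⟨k 0, by simp⟩
  rw [this, zero_add]

/-- The rotation number can be computed with any lift. -/
theorem CircleDiffeo.rotationNumber_eq_of_isLift {r : WithTop ℕ∞} (f : CircleDiffeo r)
    (F : CircleDeg1Liftˣ) (hF : IsLift F f) :
    f.rotationNumber = ((F : CircleDeg1Lift).translationNumber : UnitAddCircle) :=
  translationNumber_coe_eq_of_isLift f.lift F f.isLift_lift hF

/-- The denominator `q_n` of the `n`-th convergent `p_n / q_n = [a_0; a_1, …, a_n]` of `α`, written
in lowest terms. -/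
def convDenom (α : ℝ) (n : ℕ) : ℕ := (α.convergent n).den

/-- The open arc of the circle that goes from `a` to `b` in the positive direction. Its length is
the representative of `b - a` in `[0, 1)`. -/
def openArc (a b : UnitAddCircle) : Set UnitAddCircle :=
  (fun t : ℝ => a + (t : UnitAddCircle)) '' Ioo 0 (AddCircle.equivIco 1 0 (b - a) : ℝ)

/-- The dynamical interval `I_n(x)`: the arc from `x` to `f^{q_n}(x)` for `n` even, and the arc
from `f^{q_n}(x)` to `x` for `n` odd. -/
def dynInterval (f : UnitAddCircle → UnitAddCircle) (α : ℝ) (n : ℕ) (x : UnitAddCircle) :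
    Set UnitAddCircle :=
  if Even n then openArc x (f^[convDenom α n] x) else openArc (f^[convDenom α n] x) x

/-- `β_n(x)`, the length (Haar probability measure) of `I_n(x)`. -/
def dynLength (f : UnitAddCircle → UnitAddCircle) (α : ℝ) (n : ℕ) (x : UnitAddCircle) : ℝ :=
  (volume : Measure UnitAddCircle).real (dynInterval f α n x)

/-- `m_n`, the minimum over the circle of the lengths `β_n(x)`. -/
def minLength (f : UnitAddCircle → UnitAddCircle) (α : ℝ) (n : ℕ) : ℝ :=
  ⨅ x : UnitAddCircle, dynLength f α n x

/-- `M_n`, the maximum over the circle of the lengths `β_n(x)`. -/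
def maxLength (f : UnitAddCircle → UnitAddCircle) (α : ℝ) (n : ℕ) : ℝ :=
  ⨆ x : UnitAddCircle, dynLength f α n x

/-- `f` is conjugated to the rotation `T_α : x ↦ x + α` by an orientation preserving circle
diffeomorphism `h` of class `C^s`: `h ∘ f = T_α ∘ h`. -/
def IsConjToRotation (s : WithTop ℕ∞) (f : UnitAddCircle → UnitAddCircle) (α : ℝ) : Prop :=
  ∃ h : CircleDiffeo s, ∀ x : UnitAddCircle, h (f x) = h x + (α : UnitAddCircle)

end CircleDyn

end

namespace CircleDyn

/-! Lift `f` to `F` with translation number `α`, and let `convMap` be `F^{q_n} - p_n`. Bounded `M_n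
/ m_n` says that the displacements of this map at any two points are comparable, with a constant `C`
independent of `n`. Some point is moved by exactly `|q_n α - p_n|`, so these maps tend to the
identity.

Since `F^k` commutes with `convMap`, its difference quotient between `x` and `convMap x` is the
ratio of the displacements at `F^k x` and `x`. In the limit, `(F^k)'` lies in `[1/C, C]` for all
integers `k` (`deriv_zpow_mem_Icc`).

A Gottschalk–Hedlund argument follows (`exists_invariant_density`). The supremum `U` and infimum `L`
of `(F^k)'` over `k` satisfy `U(F x) F'(x) = U(x)`, and likewise for `L`. They are lower and upper
semicontinuous respectively, so `{U ≤ c L}` is closed and invariant. Minimality, which comes from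
`convMap` tending to the identity rather than from Denjoy's theorem, makes `U / L` constant; hence
`U` is continuous. The normalised primitive of `U` is the conjugacy. -/

/-! ### Sign and decay of the errors of the convergents -/

/-- The `n`-th convergent of `ξ` is a quotient `P / Q` for which `Q * ξ - P` has the sign `(-1) ^ n`
and absolute value less than `ε`. -/
def ConvergentErrorLT (n : ℕ) (ξ ε : ℝ) : Prop :=
  ∃ P Q : ℤ, 0 < Q ∧ ξ.convergent n = (P : ℚ) / Q ∧ (1 < ξ → 0 < P) ∧
    0 < (-1) ^ n * (Q * ξ - P) ∧ (-1) ^ n * (Q * ξ - P) < ε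

theorem irrational_fract {ξ : ℝ} (hξ : Irrational ξ) : Irrational (Int.fract ξ) := by
  rw [← Int.self_sub_floor]
  exact hξ.sub_intCast _

theorem fract_pos_of_irrational {ξ : ℝ} (hξ : Irrational ξ) : 0 < Int.fract ξ :=
  lt_of_le_of_ne (Int.fract_nonneg ξ) (irrational_fract hξ).ne_zero.symm

theorem convergentErrorLT_zero {ξ : ℝ} (hξ : Irrational ξ) : ConvergentErrorLT 0 ξ 1 := by
  refine ⟨⌊ξ⌋, 1, one_pos, by simp, fun h => Int.floor_pos.2 h.le, ?_, ?_⟩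
  · simpa [Int.self_sub_floor] using fract_pos_of_irrational hξ
  · simpa [Int.self_sub_floor] using Int.fract_lt_one ξ

/-- If `P / Q` is the convergent of `1 / {ξ}`, the next one for `ξ` is `(⌊ξ⌋ P + Q) / P`, whose
error is that of `P / Q` times `-{ξ}`. Positivity of `P` is carried along because `P` becomes a
denominator. -/
theorem ConvergentErrorLT.succ {n : ℕ} {ξ ε : ℝ} (hξ : Irrational ξ)
    (h : ConvergentErrorLT n (Int.fract ξ)⁻¹ ε) :
    ConvergentErrorLT (n + 1) ξ (Int.fract ξ * ε) := by
  have h0 := fract_pos_of_irrational hξ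
  obtain ⟨P, Q, hQ, hc, hP, hs, hl⟩ := h
  have hP := hP (one_lt_inv₀ h0 |>.2 (Int.fract_lt_one ξ))
  have key : (-1 : ℝ) ^ (n + 1) * (P * ξ - (⌊ξ⌋ * P + Q : ℤ))
      = Int.fract ξ * ((-1) ^ n * (Q * (Int.fract ξ)⁻¹ - P)) := by
    have : ξ = ⌊ξ⌋ + Int.fract ξ := (Int.floor_add_fract ξ).symm
    have e : Int.fract ξ * (Q * (Int.fract ξ)⁻¹ - P) = Q - Int.fract ξ * P := by
      field_simp
    rw [mul_left_comm, e, pow_succ]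
    conv_lhs => rw [this]
    push_cast
    simp only [Int.floor_intCast_add, Int.floor_fract, add_zero]
    ring
  refine ⟨⌊ξ⌋ * P + Q, P, hP, ?_, fun h => ?_, ?_, ?_⟩
  · have : (P : ℚ) ≠ 0 := by exact_mod_cast hP.ne'
    rw [Real.convergent_succ, hc, inv_div, eq_div_iff this, add_mul, div_mul_cancel₀ _ this]
    push_cast
    ring
  · have := Int.floor_pos.2 h.le
    positivity
  · rw [key]
    positivity
  · rw [key]
    exact mul_lt_mul_of_pos_left hl h0

theorem mul_fract_inv_le_half {x : ℝ} (h0 : 0 < x) (h1 : x < 1) :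
    x * Int.fract x⁻¹ ≤ 1 / 2 := by
  have h : x * (⌊x⁻¹⌋ + Int.fract x⁻¹) = 1 := by
    rw [Int.floor_add_fract, mul_inv_cancel₀ h0.ne']
  have hfl : (1 : ℝ) ≤ ⌊x⁻¹⌋ := by
    exact_mod_cast Int.floor_pos.2 (one_lt_inv₀ h0 |>.2 h1).le
  nlinarith [Int.fract_lt_one x⁻¹]

theorem convergentErrorLT_half_pow (n : ℕ) :
    ∀ {ξ : ℝ}, Irrational ξ → ConvergentErrorLT n ξ ((1 / 2) ^ (n / 2)) := by
  induction n using Nat.twoStepInduction with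
  | zero => exact fun hξ => by simpa using convergentErrorLT_zero hξ
  | one =>
    intro ξ hξ
    obtain ⟨P, Q, hQ, hc, hP, hs, hl⟩ :=
      (convergentErrorLT_zero (irrational_fract hξ).inv).succ hξ
    exact ⟨P, Q, hQ, hc, hP, hs, hl.trans (by simpa using Int.fract_lt_one ξ)⟩
  | more n ih _ =>
    intro ξ hξ
    have hξ' := (irrational_fract hξ).inv
    obtain ⟨P, Q, hQ, hc, hP, hs, hl⟩ := ((ih (irrational_fract hξ').inv).succ hξ').succ hξ
    -- Two continued fraction steps multiply the error by `{ξ} · {1/{ξ}}`, which is at most `1/2`.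
    refine ⟨P, Q, hQ, hc, hP, hs, hl.trans_le ?_⟩
    have := mul_fract_inv_le_half (fract_pos_of_irrational hξ) (Int.fract_lt_one ξ)
    rw [← mul_assoc, show (n + 2) / 2 = n / 2 + 1 by omega, pow_succ, mul_comm]
    gcongr

/-- The reduced denominator divides `Q`, so passing to lowest terms keeps the sign and can only
shrink the error. -/
theorem convergent_error_bounds {ξ : ℝ} (hξ : Irrational ξ) (n : ℕ) :
    0 < (-1) ^ n * ((ξ.convergent n).den * ξ - (ξ.convergent n).num) ∧
    (-1) ^ n * ((ξ.convergent n).den * ξ - (ξ.convergent n).num) < (1 / 2) ^ (n / 2) := by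
  obtain ⟨P, Q, hQ, hc, -, hs, hl⟩ := convergentErrorLT_half_pow n hξ
  set c := ξ.convergent n with hc_def
  have hQ' : (0 : ℝ) < Q := by exact_mod_cast hQ
  have hcr : (c : ℝ) = P / Q := by rw [hc]; push_cast; rfl
  have hd : (0 : ℝ) < c.den := by exact_mod_cast c.pos
  have hdQ : (c.den : ℝ) ≤ Q := by
    have : (c.den : ℤ) ∣ Q := by
      rw [hc]
      exact_mod_cast Rat.den_dvd P Q
    exact_mod_cast Int.le_of_dvd hQ this
  have e1 : (-1) ^ n * (Q * ξ - P) = Q * ((-1) ^ n * (ξ - c)) := by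
    rw [hcr]
    field_simp
  have e2 : (-1) ^ n * (c.den * ξ - c.num) = c.den * ((-1) ^ n * (ξ - c)) := by
    rw [Rat.cast_def c]
    field_simp
  rw [e1] at hs hl
  rw [e2]
  have hp := (mul_pos_iff_of_pos_left hQ').1 hs
  exact ⟨mul_pos hd hp, lt_of_le_of_lt (by gcongr) hl⟩

/-! ### Arc lengths, and circle maps through their lifts -/

theorem measureReal_openArc (a b : UnitAddCircle) :
    (volume : Measure UnitAddCircle).real (openArc a b) = (AddCircle.equivIco 1 0 (b - a) : ℝ) := by
  set t : ℝ := (AddCircle.equivIco 1 0 (b - a) : ℝ) with ht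
  have ht0 : 0 ≤ t := (AddCircle.equivIco 1 0 (b - a)).2.1
  have ht1 : t < 1 := by simpa using (AddCircle.equivIco 1 0 (b - a)).2.2
  set S : Set UnitAddCircle := (fun s : ℝ => (s : UnitAddCircle)) '' Ioo 0 t with hS
  have hSo : IsOpen S := QuotientAddGroup.isOpenMap_coe _ isOpen_Ioo
  have h1 : openArc a b = (fun x => -a + x) ⁻¹' S := by
    ext x
    constructor
    · rintro ⟨s, hs, rfl⟩
      exact ⟨s, hs, by simp⟩
    · rintro ⟨s, hs, h⟩
      exact ⟨s, hs, by simp only at h; simp [h]⟩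
  have h2 := (UnitAddCircle.measurePreserving_mk 0).measure_preimage
    hSo.measurableSet.nullMeasurableSet
  have hSm : MeasurableSet ((fun s : ℝ => (s : UnitAddCircle)) ⁻¹' S) :=
    (hSo.preimage (AddCircle.continuous_mk' 1)).measurableSet
  rw [Measure.restrict_apply hSm] at h2
  have h3 : (fun s : ℝ => (s : UnitAddCircle)) ⁻¹' S ∩ Ioc 0 (0 + 1) = Ioo 0 t := by
    ext s
    constructor
    · rintro ⟨⟨s', hs', h⟩, hs⟩
      have : s' = s := (AddCircle.coe_eq_coe_iff_of_mem_Ioc (p := (1 : ℝ)) (a := 0)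
        ⟨hs'.1, by linarith [hs'.2]⟩ hs).1 h
      exact this ▸ hs'
    · intro hs
      exact ⟨⟨s, hs, rfl⟩, hs.1, by linarith [hs.2]⟩
  rw [h3, Real.volume_Ioo, sub_zero] at h2
  rw [h1, measureReal_def, measure_preimage_add, ← h2, ENNReal.toReal_ofReal ht0]

theorem measureReal_openArc_coe {a b : ℝ} (k : ℤ) (h0 : 0 ≤ b - a - k) (h1 : b - a - k < 1) :
    (volume : Measure UnitAddCircle).real (openArc a b) = b - a - k := by
  rw [measureReal_openArc]
  have : ((b : UnitAddCircle) - a) = ((b - a - k : ℝ) : UnitAddCircle) := by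
    rw [AddCircle.coe_sub, AddCircle.coe_sub,
      (AddCircle.coe_eq_zero_iff (1 : ℝ) (x := (k : ℝ))).2 ⟨k, by simp⟩, sub_zero]
  rw [this, AddCircle.equivIco_coe_eq ⟨h0, by simpa using h1⟩]

/-- The circle map induced by a degree one lift. -/
def circleMap (F : CircleDeg1Lift) : UnitAddCircle → UnitAddCircle :=
  Function.Periodic.lift (f := fun x : ℝ => ((F x : ℝ) : UnitAddCircle)) (c := (1 : ℝ))
    fun x => by simp [F.map_add_one]

theorem circleMap_coe (F : CircleDeg1Lift) (x : ℝ) :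
    circleMap F (x : UnitAddCircle) = ((F x : ℝ) : UnitAddCircle) := rfl

theorem continuous_circleMap {F : CircleDeg1Lift} (hF : Continuous F) :
    Continuous (circleMap F) :=
  continuous_quot_lift _ ((AddCircle.continuous_mk' 1).comp hF)

/-- The circle diffeomorphism with a given lift. -/
def CircleDiffeo.ofLift {r : WithTop ℕ∞} (F : CircleDeg1Liftˣ) (h : ContDiff ℝ r (F : ℝ → ℝ))
    (h' : ContDiff ℝ r ((F⁻¹ : CircleDeg1Liftˣ) : ℝ → ℝ)) : CircleDiffeo r where
  toFun := circleMap F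
  invFun := circleMap (F⁻¹ : CircleDeg1Liftˣ)
  left_inv x := by
    induction x using QuotientAddGroup.induction_on with
    | H x => exact congrArg _ (CircleDeg1Lift.units_inv_apply_apply F x)
  right_inv x := by
    induction x using QuotientAddGroup.induction_on with
    | H x => exact congrArg _ (CircleDeg1Lift.units_apply_inv_apply F x)
  continuous_toFun := continuous_circleMap h.continuous
  continuous_invFun := continuous_circleMap h'.continuous
  exists_lift := ⟨F, circleMap_coe F, h, h'⟩

theorem CircleDiffeo.ofLift_coe {r : WithTop ℕ∞} (F : CircleDeg1Liftˣ)
    (h : ContDiff ℝ r (F : ℝ → ℝ)) (h' : ContDiff ℝ r ((F⁻¹ : CircleDeg1Liftˣ) : ℝ → ℝ)) (x : ℝ) :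
    CircleDiffeo.ofLift F h h' (x : UnitAddCircle) = ((F x : ℝ) : UnitAddCircle) := rfl

/-- A circle diffeomorphism has a lift whose translation number is a prescribed representative of
the rotation number. -/
theorem CircleDiffeo.exists_lift_translationNumber_eq {r : WithTop ℕ∞} (f : CircleDiffeo r) {α : ℝ}
    (h : f.rotationNumber = (α : UnitAddCircle)) :
    ∃ F : CircleDeg1Liftˣ, IsLift F f ∧ ContDiff ℝ r (F : ℝ → ℝ) ∧
      ContDiff ℝ r ((F⁻¹ : CircleDeg1Liftˣ) : ℝ → ℝ) ∧
      (F : CircleDeg1Lift).translationNumber = α := by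
  obtain ⟨F, hF, hs, hs'⟩ := f.exists_lift
  have e := (f.rotationNumber_eq_of_isLift F hF).symm.trans h
  rw [← sub_eq_zero, ← AddCircle.coe_sub, AddCircle.coe_eq_zero_iff] at e
  obtain ⟨k, hk⟩ := e
  have hk : (k : ℝ) = (F : CircleDeg1Lift).translationNumber - α := by simpa using hk
  set T := CircleDeg1Lift.translate (Multiplicative.ofAdd (-(k : ℝ))) with hT
  have hTx : ∀ x, T x = -(k : ℝ) + x := fun x => CircleDeg1Lift.translate_apply _ _
  have hTx' : ∀ x, (T⁻¹ : CircleDeg1Liftˣ) x = k + x := fun x => by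
    rw [hT, CircleDeg1Lift.translate_inv_apply, neg_neg]
  have hcomm : Commute (T : CircleDeg1Lift) F := by
    rw [CircleDeg1Lift.commute_iff_commute]
    intro x
    simp only [hTx]
    have := (F : CircleDeg1Lift).map_sub_int x k
    rw [neg_add_eq_sub, neg_add_eq_sub, this]
  refine ⟨T * F, fun x => ?_, ?_, ?_, ?_⟩
  · refine (hF x).trans ?_
    rw [Units.val_mul, CircleDeg1Lift.mul_apply, hTx, AddCircle.coe_add, AddCircle.coe_neg,
      (AddCircle.coe_eq_zero_iff (1 : ℝ) (x := (k : ℝ))).2 ⟨k, by simp⟩, neg_zero, zero_add]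
  · have : ((T * F : CircleDeg1Liftˣ) : ℝ → ℝ) = fun x => -(k : ℝ) + F x := funext fun x => by
      rw [Units.val_mul, CircleDeg1Lift.mul_apply, hTx]
    rw [this]
    exact contDiff_const.add hs
  · have : (((T * F)⁻¹ : CircleDeg1Liftˣ) : ℝ → ℝ)
        = fun x => (F⁻¹ : CircleDeg1Liftˣ) ((k : ℝ) + x) := funext fun x => by
      rw [mul_inv_rev, Units.val_mul, CircleDeg1Lift.mul_apply, hTx']
    rw [this]
    exact hs'.comp (contDiff_const.add contDiff_id)
  · rw [Units.val_mul, CircleDeg1Lift.translationNumber_mul_of_commute hcomm, hT,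
      CircleDeg1Lift.translationNumber_translate]
    linarith

/-! ### Displacements of `f^{q_n}` -/

/-- The lift `x ↦ F^{q_n}(x) - p_n` of `f^{q_n}` that is close to the identity. -/
noncomputable def convMap (F : CircleDeg1Lift) (α : ℝ) (n : ℕ) (x : ℝ) : ℝ :=
  (F ^ (α.convergent n).den) x - (α.convergent n).num

/-- The translation number `q_n α` of `F^{q_n}` lies strictly between two consecutive integers, one
of them `p_n`; this confines the displacement at every point to the same open interval. -/
theorem convMap_sub_mem {F : CircleDeg1Lift} {α : ℝ} (hα : Irrational α)
    (hF : F.translationNumber = α) (n : ℕ) (x : ℝ) :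
    (-1) ^ n * (convMap F α n x - x) ∈ Ioo (0 : ℝ) 1 := by
  obtain ⟨h0, h1⟩ := convergent_error_bounds hα n
  have h1 : (-1) ^ n * ((α.convergent n).den * α - (α.convergent n).num) < 1 :=
    h1.trans_le (pow_le_one₀ (by norm_num) (by norm_num))
  have hτ : (F ^ (α.convergent n).den).translationNumber = (α.convergent n).den * α := by
    rw [CircleDeg1Lift.translationNumber_pow, hF]
  set A := F ^ (α.convergent n).den
  set p := (α.convergent n).num with hp
  rcases Nat.even_or_odd n with hn | hn
  · rw [hn.neg_one_pow, one_mul] at h0 h1 ⊢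
    have a := A.lt_map_of_int_lt_translationNumber (n := p) (by linarith) x
    have b := A.map_lt_of_translationNumber_lt_int (n := p + 1) (by push_cast; linarith) x
    push_cast at b
    simp only [convMap, mem_Ioo, ← hp]
    constructor <;> linarith
  · rw [hn.neg_one_pow] at h0 h1 ⊢
    have a := A.lt_map_of_int_lt_translationNumber (n := p - 1) (by push_cast; linarith) x
    have b := A.map_lt_of_translationNumber_lt_int (n := p) (by linarith) x
    push_cast at a
    simp only [convMap, mem_Ioo, ← hp]
    constructor <;> linarith

theorem abs_convMap_sub {F : CircleDeg1Lift} {α : ℝ} (hα : Irrational α)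
    (hF : F.translationNumber = α) (n : ℕ) (x : ℝ) :
    |convMap F α n x - x| = (-1) ^ n * (convMap F α n x - x) := by
  rw [← abs_of_pos (convMap_sub_mem hα hF n x).1, abs_mul, abs_neg_one_pow, one_mul]

theorem IsLift.iterate {F : CircleDeg1Lift} {f : UnitAddCircle → UnitAddCircle} (h : IsLift F f)
    (n : ℕ) (x : ℝ) : f^[n] (x : UnitAddCircle) = (((F ^ n) x : ℝ) : UnitAddCircle) := by
  induction n with
  | zero => rfl
  | succ n ih =>
    rw [Function.iterate_succ_apply', ih, h, pow_succ', CircleDeg1Lift.mul_apply]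

theorem dynLength_coe {F : CircleDeg1Lift} {f : UnitAddCircle → UnitAddCircle} (h : IsLift F f)
    {α : ℝ} (hα : Irrational α) (hF : F.translationNumber = α) (n : ℕ) (x : ℝ) :
    dynLength f α n x = |convMap F α n x - x| := by
  obtain ⟨h0, h1⟩ := convMap_sub_mem hα hF n x
  rw [abs_convMap_sub hα hF, dynLength, dynInterval, convDenom, h.iterate]
  split_ifs with hn
  · rw [hn.neg_one_pow, one_mul, convMap] at h0 h1 ⊢
    rw [measureReal_openArc_coe (α.convergent n).num] <;> linarith
  · rw [(Nat.not_even_iff_odd.1 hn).neg_one_pow, convMap] at h0 h1 ⊢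
    -- For odd `n` the arc ends at `x`, so the integer shift changes sign.
    rw [measureReal_openArc_coe (-(α.convergent n).num)] <;> push_cast <;> linarith

theorem continuous_convMap {F : CircleDeg1Lift} (hF : Continuous F) (α : ℝ) (n : ℕ) :
    Continuous (convMap F α n) :=
  (F.continuous_pow hF _).sub continuous_const

theorem convMap_add_one (F : CircleDeg1Lift) (α : ℝ) (n : ℕ) (x : ℝ) :
    convMap F α n (x + 1) = convMap F α n x + 1 := by
  rw [convMap, CircleDeg1Lift.map_add_one, convMap]
  ring

/-- Bounded ratio `M_n / m_n` bounds the ratio of the displacements of `f^{q_n}` at any two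
points. -/
theorem exists_displacement_le_mul {F : CircleDeg1Lift} (hFc : Continuous F)
    {f : UnitAddCircle → UnitAddCircle} (h : IsLift F f)
    {α : ℝ} (hα : Irrational α) (hF : F.translationNumber = α)
    (hbdd : BddAbove (range fun n : ℕ => maxLength f α n / minLength f α n)) :
    ∃ C : ℝ, 0 < C ∧ ∀ n x y, |convMap F α n x - x| ≤ C * |convMap F α n y - y| := by
  obtain ⟨C, hC⟩ := hbdd
  have hC : ∀ n, maxLength f α n / minLength f α n ≤ C := fun n => hC ⟨n, rfl⟩
  have hpos : ∀ n x, 0 < |convMap F α n x - x| := fun n x => by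
    rw [abs_convMap_sub hα hF]
    exact (convMap_sub_mem hα hF n x).1
  -- Without `m_n > 0` the quotient `M_n / m_n` would take the default value `0` and bound nothing.
  have hmin : ∀ n, 0 < minLength f α n := fun n => by
    have hc : Continuous fun x => |convMap F α n x - x| :=
      ((continuous_convMap hFc α n).sub continuous_id).abs
    have hp : Function.Periodic (fun x => |convMap F α n x - x|) 1 := fun x => by
      simp only [convMap_add_one, add_sub_add_right_eq_sub]
    obtain ⟨x₀, -, hx₀⟩ := (isCompact_Icc (a := (0 : ℝ)) (b := 1)).exists_isMinOn
      (nonempty_Icc.2 zero_le_one) hc.continuousOn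
    refine (hpos n x₀).trans_le (le_ciInf fun z => ?_)
    induction z using QuotientAddGroup.induction_on with
    | H z =>
      change _ ≤ dynLength f α n (z : UnitAddCircle)
      rw [dynLength_coe h hα hF]
      obtain ⟨y, hy, e⟩ := hp.exists_mem_Ico₀ one_pos z
      rw [e]
      exact hx₀ (Ico_subset_Icc_self hy)
  have hmin_le : ∀ n y, minLength f α n ≤ |convMap F α n y - y| := fun n y => by
    rw [← dynLength_coe h hα hF]
    exact ciInf_le ⟨0, by rintro _ ⟨z, rfl⟩; exact measureReal_nonneg⟩ _
  have hle_max : ∀ n x, |convMap F α n x - x| ≤ maxLength f α n := fun n y => by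
    rw [← dynLength_coe h hα hF]
    refine le_ciSup (f := fun z => dynLength f α n z)
      ⟨1, forall_mem_range.2 fun z => ?_⟩ _
    induction z using QuotientAddGroup.induction_on with
    | H z =>
      change dynLength f α n (z : UnitAddCircle) ≤ 1
      rw [dynLength_coe h hα hF, abs_convMap_sub hα hF]
      exact (convMap_sub_mem hα hF n z).2.le
  have key : ∀ n x, |convMap F α n x - x| ≤ C * minLength f α n := fun n x =>
    (hle_max n x).trans ((div_le_iff₀ (hmin n)).1 (hC n))
  have hC0 : 0 < C := pos_of_mul_pos_left ((hpos 0 0).trans_le (key 0 0)) (hmin 0).le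
  exact ⟨C, hC0, fun n x y => (key n x).trans (by gcongr; exact hmin_le n y)⟩

theorem exists_abs_convMap_sub_lt {F : CircleDeg1Lift} (hFc : Continuous F)
    {α : ℝ} (hα : Irrational α) (hF : F.translationNumber = α) (n : ℕ) :
    ∃ x, |convMap F α n x - x| < (1 / 2) ^ (n / 2) := by
  obtain ⟨x, hx⟩ := (F ^ (α.convergent n).den).exists_eq_add_translationNumber
    (F.continuous_pow hFc _)
  rw [CircleDeg1Lift.translationNumber_pow, hF] at hx
  refine ⟨x, ?_⟩
  rw [abs_convMap_sub hα hF, convMap, hx]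
  exact lt_of_eq_of_lt (by ring) (convergent_error_bounds hα n).2

/-- One point moves by less than `2^{-⌊n/2⌋}`, so every point moves by at most `C` times that. -/
theorem tendsto_convMap {F : CircleDeg1Lift} (hFc : Continuous F)
    {α : ℝ} (hα : Irrational α) (hF : F.translationNumber = α) {C : ℝ} (hC0 : 0 < C)
    (hC : ∀ n x y, |convMap F α n x - x| ≤ C * |convMap F α n y - y|) (x : ℝ) :
    Tendsto (fun n => convMap F α n x) atTop (𝓝 x) := by
  rw [tendsto_iff_dist_tendsto_zero]
  have h2 : Tendsto (fun n : ℕ => n / 2) atTop atTop :=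
    Nat.tendsto_div_const_atTop (by norm_num)
  have h1 : Tendsto (fun n : ℕ => C * (1 / 2 : ℝ) ^ (n / 2)) atTop (𝓝 0) := by
    simpa using ((tendsto_pow_atTop_nhds_zero_of_lt_one (r := (1 / 2 : ℝ)) (by norm_num)
      (by norm_num)).comp h2).const_mul C
  refine squeeze_zero (fun _ => dist_nonneg) (fun n => ?_) h1
  obtain ⟨y, hy⟩ := exists_abs_convMap_sub_lt hFc hα hF n
  exact (hC n x y).trans (by gcongr)

theorem convMap_comm (F : CircleDeg1Liftˣ) (α : ℝ) (n : ℕ) (k : ℤ) (x : ℝ) :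
    convMap F α n ((F ^ k : CircleDeg1Liftˣ) x) = (F ^ k : CircleDeg1Liftˣ) (convMap F α n x) := by
  have h : F ^ (α.convergent n).den * F ^ k = F ^ k * F ^ (α.convergent n).den :=
    ((Commute.refl F).pow_left _).zpow_right k
  have h := congrArg (fun G : CircleDeg1Liftˣ => (G : CircleDeg1Lift) x) h
  simp only [Units.val_mul, CircleDeg1Lift.mul_apply, Units.val_pow_eq_pow_val] at h
  rw [convMap, convMap, CircleDeg1Lift.map_sub_int, h]

/-! ### Uniform bounds on the derivatives of the iterates -/

theorem contDiff_pow {F : CircleDeg1Lift} {r : WithTop ℕ∞} (h : ContDiff ℝ r F) (n : ℕ) :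
    ContDiff ℝ r (F ^ n : CircleDeg1Lift) := by
  induction n with
  | zero => exact contDiff_id
  | succ n ih =>
    rw [pow_succ, CircleDeg1Lift.coe_mul]
    exact ih.comp h

theorem contDiff_zpow {F : CircleDeg1Liftˣ} {r : WithTop ℕ∞} (h : ContDiff ℝ r (F : ℝ → ℝ))
    (h' : ContDiff ℝ r ((F⁻¹ : CircleDeg1Liftˣ) : ℝ → ℝ)) (k : ℤ) :
    ContDiff ℝ r ((F ^ k : CircleDeg1Liftˣ) : ℝ → ℝ) := by
  cases k with
  | ofNat n =>
    rw [Int.ofNat_eq_natCast, zpow_natCast, Units.val_pow_eq_pow_val]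
    exact contDiff_pow h n
  | negSucc n =>
    rw [zpow_negSucc, ← inv_pow, Units.val_pow_eq_pow_val]
    exact contDiff_pow h' (n + 1)

/-- The derivatives of all iterates, positive and negative, are uniformly bounded away from `0` and
infinity. -/
theorem deriv_zpow_mem_Icc {F : CircleDeg1Liftˣ} (h : ContDiff ℝ 1 (F : ℝ → ℝ))
    (h' : ContDiff ℝ 1 ((F⁻¹ : CircleDeg1Liftˣ) : ℝ → ℝ))
    {α : ℝ} (hα : Irrational α) (hF : (F : CircleDeg1Lift).translationNumber = α) {C : ℝ}
    (hC0 : 0 < C)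
    (hC : ∀ n x y, |convMap F α n x - x| ≤ C * |convMap F α n y - y|) (k : ℤ) (x : ℝ) :
    deriv ((F ^ k : CircleDeg1Liftˣ) : ℝ → ℝ) x ∈ Icc C⁻¹ C := by
  set G : ℝ → ℝ := ((F ^ k : CircleDeg1Liftˣ) : ℝ → ℝ) with hG
  have hpos : ∀ n x, 0 < |convMap F α n x - x| := fun n x => by
    rw [abs_convMap_sub hα hF]
    exact (convMap_sub_mem hα hF n x).1
  have hd : HasDerivAt G (deriv G x) x :=
    ((contDiff_zpow h h' k).differentiable one_ne_zero x).hasDerivAt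
  have ht : Tendsto (fun n => convMap F α n x) atTop (𝓝[≠] x) :=
    tendsto_nhdsWithin_iff.2 ⟨tendsto_convMap h.continuous hα hF hC0 hC x,
      Eventually.of_forall fun n => fun e => (hpos n x).ne' (by rw [mem_singleton_iff.1 e]; simp)⟩
  refine isClosed_Icc.mem_of_tendsto ((hasDerivAt_iff_tendsto_slope.1 hd).comp ht)
    (Eventually.of_forall fun n => ?_)
  -- Monotonicity makes the slope nonnegative, so it equals the ratio of absolute displacements.
  have hm : Monotone G := (F ^ k : CircleDeg1Liftˣ).val.monotone
  have hs : 0 ≤ slope G x (convMap F α n x) := by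
    rw [slope_def_field]
    rcases le_total x (convMap F α n x) with hx | hx
    · exact div_nonneg (sub_nonneg.2 (hm hx)) (sub_nonneg.2 hx)
    · exact div_nonneg_of_nonpos (sub_nonpos.2 (hm hx)) (sub_nonpos.2 hx)
  rw [Function.comp_apply, ← abs_of_nonneg hs, slope_def_field, abs_div, hG, ← convMap_comm]
  exact ⟨by rw [le_div_iff₀ (hpos n x), inv_mul_le_iff₀ hC0]; exact hC n _ _,
    by rw [div_le_iff₀ (hpos n x)]; exact hC n _ _⟩

/-! ### Minimality and the invariant density -/

/-- A nonempty closed subset of `ℝ` that is invariant under `F` and under integer translations is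
everything. -/
theorem eq_univ_of_isClosed_of_invariant {F : CircleDeg1Lift}
    {α : ℝ} (hα : Irrational α) (hF : F.translationNumber = α)
    (ht : ∀ x, Tendsto (fun n => convMap F α n x) atTop (𝓝 x)) {S : Set ℝ} (hS : IsClosed S)
    (hne : S.Nonempty) (hSF : ∀ x ∈ S, F x ∈ S) (hSZ : ∀ x ∈ S, ∀ m : ℤ, x - m ∈ S) :
    S = univ := by
  refine eq_univ_of_forall fun y => ?_
  by_contra hy
  have hSF' : ∀ (m : ℕ), ∀ x ∈ S, (F ^ m) x ∈ S := fun m => by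
    rw [CircleDeg1Lift.coe_pow]
    exact fun x hx => (show MapsTo F S S from hSF).iterate m hx
  obtain ⟨x, hx⟩ := hne
  have hne' : (S ∩ Iic y).Nonempty := ⟨x - ⌈x - y⌉, hSZ x hx _, by
    have := Int.le_ceil (x - y)
    simp only [mem_Iic]
    linarith⟩
  -- Let `s` be the largest point of `S` below `y`. For large even `n`, `convMap` moves `s` to the
  -- right, within `S` and short of `y`, a contradiction.
  have hs := (hS.inter isClosed_Iic).csSup_mem hne' ⟨y, fun z hz => hz.2⟩
  set s := sSup (S ∩ Iic y) with hs_def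
  have hsy : s < y := lt_of_le_of_ne hs.2 fun e => hy (e ▸ hs.1)
  obtain ⟨N, hN⟩ := eventually_atTop.1 ((ht s).eventually_lt_const hsy)
  have h1 := hN (2 * N) (by omega)
  have h2 := (convMap_sub_mem hα hF (2 * N) s).1
  rw [(even_two_mul N).neg_one_pow, one_mul] at h2
  have h3 : convMap F α (2 * N) s ≤ s :=
    le_csSup ⟨y, fun z hz => hz.2⟩ ⟨hSZ _ (hSF' _ _ hs.1) _, h1.le⟩
  linarith

theorem deriv_zpow_add_one {F : CircleDeg1Liftˣ} (h : ContDiff ℝ 1 (F : ℝ → ℝ))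
    (h' : ContDiff ℝ 1 ((F⁻¹ : CircleDeg1Liftˣ) : ℝ → ℝ)) (k : ℤ) (x : ℝ) :
    deriv ((F ^ (k + 1) : CircleDeg1Liftˣ) : ℝ → ℝ) x
      = deriv ((F ^ k : CircleDeg1Liftˣ) : ℝ → ℝ) (F x) * deriv (F : ℝ → ℝ) x := by
  rw [zpow_add_one, Units.val_mul, CircleDeg1Lift.coe_mul]
  exact deriv_comp x ((contDiff_zpow h h' k).differentiable one_ne_zero _)
    (h.differentiable one_ne_zero _)

/-- If the derivatives of the iterates are uniformly bounded, then `F` preserves a continuous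
positive density. -/
theorem exists_invariant_density {F : CircleDeg1Liftˣ} (h : ContDiff ℝ 1 (F : ℝ → ℝ))
    (h' : ContDiff ℝ 1 ((F⁻¹ : CircleDeg1Liftˣ) : ℝ → ℝ))
    {α : ℝ} (hα : Irrational α) (hF : (F : CircleDeg1Lift).translationNumber = α)
    (ht : ∀ x, Tendsto (fun n => convMap F α n x) atTop (𝓝 x)) {C : ℝ} (hC0 : 0 < C)
    (hD : ∀ (k : ℤ) (x : ℝ), deriv ((F ^ k : CircleDeg1Liftˣ) : ℝ → ℝ) x ∈ Icc C⁻¹ C) :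
    ∃ U : ℝ → ℝ, Continuous U ∧ (∀ x, 0 < U x) ∧ (∀ x, U (x + 1) = U x) ∧
      ∀ x, U (F x) * deriv (F : ℝ → ℝ) x = U x := by
  set D : ℤ → ℝ → ℝ := fun k => deriv ((F ^ k : CircleDeg1Liftˣ) : ℝ → ℝ) with hD_def
  have hDc : ∀ k, Continuous (D k) := fun k => (contDiff_zpow h h' k).continuous_deriv le_rfl
  have hDpos : ∀ k x, 0 < D k x := fun k x => (inv_pos.2 hC0).trans_le (hD k x).1
  have hF' : ∀ x, 0 < deriv (F : ℝ → ℝ) x := fun x => by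
    have := hDpos 1 x
    simpa only [hD_def, zpow_one] using this
  have hDF : ∀ k x, D (k + 1) x = D k (F x) * deriv (F : ℝ → ℝ) x := deriv_zpow_add_one h h'
  have hD1 : ∀ k (m : ℤ) x, D k (x - m) = D k x := fun k m x => by
    have e : (fun y => ((F ^ k : CircleDeg1Liftˣ) : ℝ → ℝ) (y - m))
        = fun y => ((F ^ k : CircleDeg1Liftˣ) : ℝ → ℝ) y - m :=
      funext fun y => CircleDeg1Lift.map_sub_int _ y m
    have := congrArg (fun g => deriv g x) e
    simpa only [deriv_comp_sub_const, deriv_sub_const] using this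
  have hbA : ∀ x, BddAbove (range fun k => D k x) := fun x =>
    ⟨C, forall_mem_range.2 fun k => (hD k x).2⟩
  have hbB : ∀ x, BddBelow (range fun k => D k x) := fun x =>
    ⟨C⁻¹, forall_mem_range.2 fun k => (hD k x).1⟩
  set U : ℝ → ℝ := fun x => ⨆ k, D k x with hU
  set L : ℝ → ℝ := fun x => ⨅ k, D k x with hL
  have hLpos : ∀ x, 0 < L x := fun x => (inv_pos.2 hC0).trans_le (le_ciInf fun k => (hD k x).1)
  have hUpos : ∀ x, 0 < U x := fun x => (hDpos 0 x).trans_le (le_ciSup (hbA x) 0)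
  -- By the chain rule, multiplying by `F'(x)` only shifts the index `k`, which runs over all of
  -- `ℤ`.
  have hUF : ∀ x, U (F x) * deriv (F : ℝ → ℝ) x = U x := fun x => by
    rw [hU]
    simp only [Real.iSup_mul_of_nonneg (hF' x).le, ← hDF]
    exact (Equiv.addRight (1 : ℤ)).iSup_comp (g := fun k => D k x)
  have hLF : ∀ x, L (F x) * deriv (F : ℝ → ℝ) x = L x := fun x => by
    rw [hL]
    simp only [Real.iInf_mul_of_nonneg (hF' x).le, ← hDF]
    exact (Equiv.addRight (1 : ℤ)).iInf_comp (g := fun k => D k x)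
  have hU1 : ∀ x (m : ℤ), U (x - m) = U x := fun x m => by simp only [hU, hD1]
  have hL1 : ∀ x (m : ℤ), L (x - m) = L x := fun x m => by simp only [hL, hD1]
  have hUs : LowerSemicontinuous U := lowerSemicontinuous_ciSup hbA
    fun k => (hDc k).lowerSemicontinuous
  have hLs : UpperSemicontinuous L := upperSemicontinuous_ciInf hbB
    fun k => (hDc k).upperSemicontinuous
  have hle : ∀ c, 0 < c → (∃ x, U x ≤ c * L x) → ∀ x, U x ≤ c * L x := by
    intro c hc hx
    have hcl : IsClosed {x | U x ≤ c * L x} := by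
      have h1 : LowerSemicontinuous fun x => -(c * L x) := by
        have : (fun x => -(c * L x)) = (fun t : ℝ => -(c * t)) ∘ L := rfl
        rw [this]
        exact (continuous_const.mul continuous_id).neg.comp_upperSemicontinuous_antitone hLs
          fun a b hab => neg_le_neg (mul_le_mul_of_nonneg_left hab hc.le)
      have h2 := (hUs.add h1).isClosed_preimage 0
      convert h2 using 1
      ext x
      simp [← sub_eq_add_neg]
    refine fun x => (eq_univ_of_isClosed_of_invariant hα hF ht hcl hx ?_ ?_).ge (mem_univ x)
    · intro x hx
      have hx : U x ≤ c * L x := hx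
      rw [← hUF, ← hLF, ← mul_assoc] at hx
      exact le_of_mul_le_mul_right hx (hF' x)
    · intro x hx m
      simpa only [mem_ofPred_eq, hU1, hL1] using hx
  set c := U 0 / L 0 with hc
  have hc0 : 0 < c := div_pos (hUpos 0) (hLpos 0)
  -- Comparing from `0` to `x` with ratio `c`, and from `x` to `0` with ratio `U x / L x`, gives
  -- both inequalities.
  have hUL : ∀ x, U x = c * L x := by
    intro x
    refine le_antisymm (hle c hc0 ⟨0, by rw [hc, div_mul_cancel₀ _ (hLpos 0).ne']⟩ x) ?_
    have := hle (U x / L x) (div_pos (hUpos x) (hLpos x))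
      ⟨x, by rw [div_mul_cancel₀ _ (hLpos x).ne']⟩ 0
    rw [hc, ← le_div_iff₀ (hLpos x), div_le_iff₀ (hLpos 0)]
    exact this
  have hUu : UpperSemicontinuous U := by
    have : U = (fun t : ℝ => c * t) ∘ L := funext hUL
    rw [this]
    exact (continuous_const.mul continuous_id).comp_upperSemicontinuous hLs
      fun a b hab => mul_le_mul_of_nonneg_left hab hc0.le
  refine ⟨U, continuous_iff_lower_upperSemicontinuous.2 ⟨hUs, hUu⟩, hUpos, fun x => ?_, hUF⟩
  simpa using (hU1 (x + 1) 1).symm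

/-! ### Integrating the density to a conjugacy -/

/-- The lift with derivative a given continuous positive periodic density of integral one. -/
theorem exists_lift_hasDerivAt {U : ℝ → ℝ} (hU : Continuous U) (hpos : ∀ x, 0 < U x)
    (hper : ∀ x, U (x + 1) = U x) (hint : ∫ t in (0 : ℝ)..1, U t = 1) :
    ∃ H : CircleDeg1Liftˣ, ContDiff ℝ 1 (H : ℝ → ℝ) ∧
      ContDiff ℝ 1 ((H⁻¹ : CircleDeg1Liftˣ) : ℝ → ℝ) ∧ ∀ x, HasDerivAt (H : ℝ → ℝ) (U x) x := by
  set G : ℝ → ℝ := fun x => ∫ t in (0 : ℝ)..x, U t with hG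
  have hd : ∀ x, HasDerivAt G (U x) x := fun x =>
    intervalIntegral.integral_hasDerivAt_right (hU.intervalIntegrable _ _)
      (hU.stronglyMeasurableAtFilter _ _) hU.continuousAt
  have hm : StrictMono G := strictMono_of_deriv_pos fun x => by rw [(hd x).deriv]; exact hpos x
  have hG1 : ∀ x, G (x + 1) = G x + 1 := fun x => by
    have hp := (show Function.Periodic U 1 from hper).intervalIntegral_add_eq x 0
    rw [zero_add, hint] at hp
    change ∫ t in (0 : ℝ)..(x + 1), U t = (∫ t in (0 : ℝ)..x, U t) + 1
    rw [← intervalIntegral.integral_add_adjacent_intervals (hU.intervalIntegrable 0 x)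
      (hU.intervalIntegrable x (x + 1)), hp]
  have hGc : Continuous G := continuous_iff_continuousAt.2 fun x => (hd x).continuousAt
  set H₀ : CircleDeg1Lift := ⟨⟨G, hm.monotone⟩, hG1⟩ with hH₀
  have hsurj : Function.Surjective H₀ := H₀.continuous_iff_surjective.1 hGc
  obtain ⟨H, hH⟩ := CircleDeg1Lift.isUnit_iff_bijective.2 ⟨hm.injective, hsurj⟩
  have hHG : (H : ℝ → ℝ) = G := by rw [hH]; rfl
  have hs : ContDiff ℝ 1 G := contDiff_one_iff_deriv.2
    ⟨fun x => (hd x).differentiableAt, by rwa [show deriv G = U from funext fun x => (hd x).deriv]⟩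
  -- The inverse is `C^1` because the derivative `U` never vanishes.
  have hs' := (CircleDeg1Lift.toOrderIso H).toHomeomorph.contDiff_symm_deriv (n := 1)
    (f' := U) (fun x => (hpos x).ne') (by simpa [hHG] using hd) (by simpa [hHG] using hs)
  exact ⟨H, hHG ▸ hs, hs', fun x => hHG ▸ hd x⟩

/-- A lift that preserves a continuous positive density is `C^1`-conjugated to a translation. -/
theorem exists_conj_translation {F : CircleDeg1Liftˣ} (h : ContDiff ℝ 1 (F : ℝ → ℝ))
    {U : ℝ → ℝ} (hU : Continuous U) (hpos : ∀ x, 0 < U x) (hper : ∀ x, U (x + 1) = U x)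
    (hinv : ∀ x, U (F x) * deriv (F : ℝ → ℝ) x = U x) :
    ∃ H : CircleDeg1Liftˣ, ContDiff ℝ 1 (H : ℝ → ℝ) ∧
      ContDiff ℝ 1 ((H⁻¹ : CircleDeg1Liftˣ) : ℝ → ℝ) ∧
      ∀ x, H (F x) = H x + (F : CircleDeg1Lift).translationNumber := by
  set I := ∫ t in (0 : ℝ)..1, U t with hI
  have hI0 : 0 < I := intervalIntegral.intervalIntegral_pos_of_pos
    (hU.intervalIntegrable _ _) hpos one_pos
  obtain ⟨H, hs, hs', hd⟩ := exists_lift_hasDerivAt (U := fun x => U x / I)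
    (hU.div_const I) (fun x => div_pos (hpos x) hI0) (fun x => by rw [hper])
    (by rw [intervalIntegral.integral_div, ← hI, div_self hI0.ne'])
  refine ⟨H, hs, hs', ?_⟩
  have hF : ∀ x, HasDerivAt (F : ℝ → ℝ) (deriv (F : ℝ → ℝ) x) x := fun x =>
    (h.differentiable one_ne_zero x).hasDerivAt
  have hd0 : ∀ x, HasDerivAt (fun x => H (F x) - H x) 0 x := fun x => by
    have := ((hd (F x)).comp x (hF x)).sub (hd x)
    rwa [div_mul_eq_mul_div, hinv, sub_self] at this
  have hconst := is_const_of_deriv_eq_zero (fun x => (hd0 x).differentiableAt)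
    (fun x => (hd0 x).deriv)
  set c := H (F 0) - H 0 with hc
  have hHF : ∀ x, H (F x) = H x + c := fun x => by
    have := hconst x 0
    linarith
  -- `H` semiconjugates `F` to the translation by `c`, and semiconjugate lifts have the same
  -- translation number.
  have hτ : (F : CircleDeg1Lift).translationNumber = c := by
    rw [← CircleDeg1Lift.translationNumber_translate c]
    refine CircleDeg1Lift.translationNumber_eq_of_semiconj (f := (H : CircleDeg1Lift)) fun x => ?_
    rw [CircleDeg1Lift.translate_apply, hHF, add_comm]
  rw [hτ]
  exact hHF

end CircleDyn

theorem mainTheorem3 (r : WithTop ℕ∞) (hr : 1 ≤ r) (f : CircleDyn.CircleDiffeo r)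
    (α : ℝ) (hα : α ∈ Set.Ioo (0 : ℝ) 1) (hirr : Irrational α)
    (hrot : f.rotationNumber = (α : UnitAddCircle))
    (hbdd : BddAbove (Set.range fun n : ℕ =>
      CircleDyn.maxLength f α n / CircleDyn.minLength f α n)) :
    CircleDyn.IsConjToRotation 1 f α := by
  obtain ⟨F, hFf, hs, hs', hτ⟩ := f.exists_lift_translationNumber_eq hrot
  have hs := hs.of_le hr
  have hs' := hs'.of_le hr
  obtain ⟨C, hC0, hC⟩ := CircleDyn.exists_displacement_le_mul hs.continuous hFf hirr hτ hbdd
  obtain ⟨U, hU, hpos, hper, hinv⟩ := CircleDyn.exists_invariant_density hs hs' hirr hτ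
    (CircleDyn.tendsto_convMap hs.continuous hirr hτ hC0 hC) hC0
    (CircleDyn.deriv_zpow_mem_Icc hs hs' hirr hτ hC0 hC)
  obtain ⟨H, hH, hH', hconj⟩ := CircleDyn.exists_conj_translation hs hU hpos hper hinv
  refine ⟨CircleDyn.CircleDiffeo.ofLift H hH hH', fun x => ?_⟩
  induction x using QuotientAddGroup.induction_on with
  | H x =>
    have e : f (x : UnitAddCircle) = ((F x : ℝ) : UnitAddCircle) := hFf x
    change CircleDyn.CircleDiffeo.ofLift H hH hH' (f (x : UnitAddCircle))
      = CircleDyn.CircleDiffeo.ofLift H hH hH' (x : UnitAddCircle) + _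
    rw [e, CircleDyn.CircleDiffeo.ofLift_coe, CircleDyn.CircleDiffeo.ofLift_coe, hconj, hτ,
      AddCircle.coe_add]
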